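/- Let $G$ be a (discrete) group. A Hilbert $\mathcal N(G)$-module is a complex Hilbert space $V$ with a linear isometric $G$-action that admits an isometric linear $G$-embedding into $H\otimes\ell^2(G)$ for some Hilbert space $H$. Its von Neumann dimension is $\dim_{\mathcal N(G)}(V)=\sum_i\langle \mathrm{pr}(b_i\otimes e),b_i\otimes e\rangle\in[0,\infty]$, where $\mathrm{pr}$ is the orthogonal projection onto the image of such an embedding and $(b_i)_i$ is a Hilbert basis of $H$ (this is independent of the choices); $V$ is finite-dimensional if $\dim_{\mathcal N(G)}(V)<\infty$. A morphism is a bounded $G$-equivariant operator. For a morphism $f\colon U\to V$ of finite-dimensional Hilbert $\mathcal N(G)$-modules, the spectral density function is $$F(f)(\lambda)=\sup\{\dim_{\mathcal N(G)}(L)\},\qquad \lambda\ge 0,$$ where $L$ runs over the closed $G$-invariant linear subspaces of $U$ with $\|f(x)\|\le\lambda\|x\|$ for all $x\in L$, and the Fuglede–Kadison determinant is $$\det\nolimits_{\mathcal N(G)}(f)=\exp\Bigl(\int_{0+}^{\infty}\ln(\lambda)\,dF(f)(\lambda)\Bigr)\in[0,\infty)$$ if the integral is $>-\infty$, and $\det_{\mathcal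 N(G)}(f)=0$ otherwise; here $\int_{0+}^\infty$ denotes integration over $(0,\infty)$, so that the kernel of $f$ does not contribute. Let $U,V$ be finite-dimensional Hilbert $\mathcal N(G)$-modules and let $f_n$ ($n\in\mathbb N$) and $f$ be morphisms $U\to V$ such that $(f_n)_{n\ge 0}$ converges to $f$ in the operator norm. Then: 1. $\displaystyle\limsup_{n\to\infty}\dim_{\mathcal N(G)}(\ker f_n)\le\dim_{\mathcal N(G)}(\ker f)$; 2. $\displaystyle\limsup_{n\to\infty}\det\nolimits_{\mathcal N(G)}(f_n)\le\det\nolimits_{\mathcal N(G)}(f)$. -/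

import Mathlib

open Filter Topology MeasureTheory
open scoped ENNReal

noncomputable section

universe u v w

/-- The Hilbert space `H ⊗ ℓ²(G)`, where `H` is a Hilbert space with a Hilbert basis indexed by
`ι`, realised as the square-summable functions on `ι × G`. -/
abbrev L2Free (ι : Type u) (G : Type v) : Type (max u v) :=
  lp (fun _ : ι × G => ℂ) 2

/-- A Hilbert `𝓝(G)`-module: a complex Hilbert space `V` with a linear isometric left action of the
(discrete) group `G` that admits an isometric linear `G`-embedding into some `H ⊗ ℓ²(G)`, on which
`g` acts by `(g • x) (i, h) = x (i, g⁻¹ h)`. Only the existence of an embedding is required. -/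
class HilbertModule (G : Type v) [Group G] (V : Type u) [NormedAddCommGroup V]
    [InnerProductSpace ℂ V] [CompleteSpace V] where
  rep : G →* (V ≃ₗᵢ[ℂ] V)
  exists_embedding : ∃ (ι : Type u) (j : V →ₗᵢ[ℂ] L2Free ι G),
    ∀ (g : G) (x : V) (i : ι) (h : G), j (rep g x) (i, h) = j x (i, g⁻¹ * h)

namespace HilbertModule

lemma enorm_sq_eq_tsum {G : Type v} {ι : Type u} (x : L2Free ι G) :
    ENNReal.ofReal (‖x‖ ^ 2) = ∑' p, ENNReal.ofReal (‖x p‖ ^ 2) := by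
  have h := lp.hasSum_norm (p := 2) (by norm_num) x
  simp only [ENNReal.toReal_ofNat, Real.rpow_ofNat] at h
  rw [← h.tsum_eq, ENNReal.ofReal_tsum_of_nonneg (fun _ => by positivity) h.summable]

variable (G : Type v) [Group G]

section Dimension

variable (V : Type u) [NormedAddCommGroup V] [InnerProductSpace ℂ V] [CompleteSpace V]
  [HilbertModule G V]

/-- An isometric linear `G`-embedding of `V` into `H ⊗ ℓ²(G)`. -/
structure Embedding (ι : Type u) where
  toIso : V →ₗᵢ[ℂ] L2Free ι G
  map_rep : ∀ (g : G) (x : V) (i : ι) (h : G),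
    toIso (rep g x) (i, h) = toIso x (i, g⁻¹ * h)

/-- The vector `b_i ⊗ e` of `H ⊗ ℓ²(G)`, with `e` the unit of `G`. -/
def unitVec {ι : Type u} (i : ι) : L2Free ι G :=
  letI := Classical.decEq (ι × G)
  lp.single 2 (i, (1 : G)) (1 : ℂ)

variable {G V}

/-- The orthogonal projection of `H ⊗ ℓ²(G)` onto the image of an embedding `j`, as `j ∘ j†`. -/
def Embedding.proj {ι : Type u} (j : Embedding G V ι) : L2Free ι G →L[ℂ] L2Free ι G :=
  j.toIso.toContinuousLinearMap ∘L ContinuousLinearMap.adjoint j.toIso.toContinuousLinearMap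

/-- The von Neumann trace `∑ i, ⟨pr (b_i ⊗ e), b_i ⊗ e⟩ ∈ [0, ∞]` of the projection `pr` onto the
image of an embedding. -/
def Embedding.trace {ι : Type u} (j : Embedding G V ι) : ℝ≥0∞ :=
  ∑' i : ι, ENNReal.ofReal (inner ℂ (unitVec G i) (j.proj (unitVec G i))).re

variable (G V)

/-- The von Neumann dimension `dim_{𝓝(G)} V ∈ [0, ∞]`, i.e. the trace of the identity of `V`,
computed in any embedding (see `vnDim_eq` for the independence of the choice). -/
def vnDim : ℝ≥0∞ :=
  (⟨exists_embedding.choose_spec.choose, exists_embedding.choose_spec.choose_spec⟩ :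
    Embedding G V (exists_embedding (G := G) (V := V)).choose).trace

variable {G V}

lemma inner_unitVec {ι : Type u} (i : ι) (x : L2Free ι G) :
    inner ℂ (unitVec G i) x = x (i, 1) := by
  classical
  have h := lp.inner_single_left (𝕜 := ℂ) (G := fun _ : ι × G => ℂ) (i, (1 : G)) (1 : ℂ) x
  simp only [unitVec]
  convert h using 1
  · congr!
  · simp

lemma Embedding.trace_eq {ι : Type u} (j : Embedding G V ι) :
    j.trace = ∑' i : ι, ENNReal.ofReal
      (‖ContinuousLinearMap.adjoint j.toIso.toContinuousLinearMap (unitVec G i)‖ ^ 2) := by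
  unfold Embedding.trace
  congr 1
  funext i
  congr 1
  rw [Embedding.proj, ContinuousLinearMap.comp_apply, ← ContinuousLinearMap.adjoint_inner_left,
    inner_self_eq_norm_sq_to_K]
  norm_cast

lemma rep_inv_rep (g : G) (x : V) : rep g (rep g⁻¹ x) = x := by
  have : (rep g * rep g⁻¹ : V ≃ₗᵢ[ℂ] V) x = x := by rw [← map_mul]; simp
  exact this

lemma norm_coeff_comm {ι κ : Type u} (j : Embedding G V ι) (k : Embedding G V κ)
    (a : ι) (b : κ) (g : G) :
    ‖k.toIso (ContinuousLinearMap.adjoint j.toIso.toContinuousLinearMap (unitVec G a)) (b, g)‖ =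
    ‖j.toIso (ContinuousLinearMap.adjoint k.toIso.toContinuousLinearMap (unitVec G b))
      (a, g⁻¹)‖ := by
  set v := ContinuousLinearMap.adjoint j.toIso.toContinuousLinearMap (unitVec G a) with hv
  set w := ContinuousLinearMap.adjoint k.toIso.toContinuousLinearMap (unitVec G b) with hw
  have h1 : k.toIso v (b, g) = inner ℂ w (rep g⁻¹ v) := by
    rw [hw, ContinuousLinearMap.adjoint_inner_left]
    have := inner_unitVec b (k.toIso (rep g⁻¹ v))
    rw [k.map_rep] at this
    simpa using this.symm
  have h2 : j.toIso w (a, g⁻¹) = inner ℂ v (rep g w) := by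
    rw [hv, ContinuousLinearMap.adjoint_inner_left]
    have := inner_unitVec a (j.toIso (rep g w))
    rw [j.map_rep] at this
    simpa using this.symm
  rw [h1, h2, ← LinearIsometryEquiv.inner_map_map (rep g : V ≃ₗᵢ[ℂ] V) w, rep_inv_rep,
    norm_inner_symm]

/-- The trace does not depend on the embedding. -/
lemma Embedding.trace_eq_trace {ι κ : Type u} (j : Embedding G V ι) (k : Embedding G V κ) :
    j.trace = k.trace := by
  rw [j.trace_eq, k.trace_eq]
  calc _ = ∑' a : ι, ∑' b : κ, ∑' g : G, ENNReal.ofReal (‖k.toIso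
            (ContinuousLinearMap.adjoint j.toIso.toContinuousLinearMap (unitVec G a))
              (b, g)‖ ^ 2) := by
        congr 1; funext a
        rw [← ENNReal.tsum_prod, ← k.toIso.norm_map, enorm_sq_eq_tsum]
    _ = ∑' b : κ, ∑' a : ι, ∑' g : G, ENNReal.ofReal (‖j.toIso
            (ContinuousLinearMap.adjoint k.toIso.toContinuousLinearMap (unitVec G b))
              (a, g)‖ ^ 2) := by
        rw [ENNReal.tsum_comm]
        congr 1; funext b; congr 1; funext a
        rw [← (Equiv.inv G).tsum_eq]
        congr 1; funext g
        rw [norm_coeff_comm]; simp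
    _ = _ := by
        congr 1; funext b
        rw [← ENNReal.tsum_prod, ← j.toIso.norm_map, enorm_sq_eq_tsum]

lemma vnDim_eq {ι : Type u} (j : Embedding G V ι) : vnDim G V = j.trace :=
  Embedding.trace_eq_trace _ _

end Dimension

section Submodules

variable (U : Type u) [NormedAddCommGroup U] [InnerProductSpace ℂ U] [CompleteSpace U]
  [HilbertModule G U]

/-- A Hilbert `𝓝(G)`-submodule: a closed `G`-invariant linear subspace. -/
structure Sub where
  carrier : Submodule ℂ U
  isClosed : IsClosed (carrier : Set U)
  rep_mem : ∀ (g : G) (x : U), x ∈ carrier → rep g x ∈ carrier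

variable {G U}

instance (L : Sub G U) : CompleteSpace L.carrier :=
  L.isClosed.completeSpace_coe

/-- The restricted action of `G` on a Hilbert submodule. -/
def Sub.restrictRep (L : Sub G U) : G →* (L.carrier ≃ₗᵢ[ℂ] L.carrier) where
  toFun g :=
    { toFun := fun x => ⟨rep g x.1, L.rep_mem g _ x.2⟩
      invFun := fun x => ⟨rep g⁻¹ x.1, L.rep_mem g⁻¹ _ x.2⟩
      map_add' := fun x y => Subtype.ext (by simp)
      map_smul' := fun c x => Subtype.ext (by simp)
      left_inv := fun x => Subtype.ext (by simp)
      right_inv := fun x => Subtype.ext (by simp)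
      norm_map' := fun x => LinearIsometryEquiv.norm_map (rep g : U ≃ₗᵢ[ℂ] U) x.1 }
  map_one' := by ext x; simp
  map_mul' g h := by ext x; simp

instance (L : Sub G U) : HilbertModule G L.carrier where
  rep := L.restrictRep
  exists_embedding := by
    obtain ⟨ι, j, hj⟩ := exists_embedding (G := G) (V := U)
    exact ⟨ι, j.comp L.carrier.subtypeₗᵢ, fun g x i h => hj g x.1 i h⟩

lemma vnDim_sub_le (L : Sub G U) : vnDim G L.carrier ≤ vnDim G U := by
  obtain ⟨ι, j, hj⟩ := exists_embedding (G := G) (V := U)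
  rw [vnDim_eq (⟨j, hj⟩ : Embedding G U ι),
    vnDim_eq (⟨j.comp L.carrier.subtypeₗᵢ, fun g x i h => hj g x.1 i h⟩ :
      Embedding G L.carrier ι), Embedding.trace_eq, Embedding.trace_eq]
  refine ENNReal.tsum_le_tsum fun i => ENNReal.ofReal_le_ofReal ?_
  have h : (j.comp L.carrier.subtypeₗᵢ).toContinuousLinearMap =
      j.toContinuousLinearMap ∘L L.carrier.subtypeₗᵢ.toContinuousLinearMap := rfl
  simp only [h, ContinuousLinearMap.adjoint_comp, ContinuousLinearMap.comp_apply]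
  gcongr
  refine (ContinuousLinearMap.le_opNorm _ _).trans (mul_le_of_le_one_left (norm_nonneg _) ?_)
  rw [LinearIsometryEquiv.norm_map]
  exact L.carrier.subtypeₗᵢ.norm_toContinuousLinearMap_le

end Submodules

/-- `V` is finite-dimensional as a Hilbert `𝓝(G)`-module: `dim_{𝓝(G)} V < ∞`. -/
class FiniteVNDim (V : Type u) [NormedAddCommGroup V] [InnerProductSpace ℂ V] [CompleteSpace V]
    [HilbertModule G V] : Prop where
  vnDim_lt_top : vnDim G V < ⊤

section Morphisms

variable (U : Type u) [NormedAddCommGroup U] [InnerProductSpace ℂ U] [CompleteSpace U]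
  [HilbertModule G U]
  (V : Type w) [NormedAddCommGroup V] [InnerProductSpace ℂ V] [CompleteSpace V]
  [HilbertModule G V]

/-- A morphism of Hilbert `𝓝(G)`-modules: a bounded `G`-equivariant operator. -/
structure Hom where
  toCLM : U →L[ℂ] V
  map_rep : ∀ (g : G) (x : U), toCLM (rep g x) = rep g (toCLM x)

variable {G U V}

/-- The kernel of a morphism, as a Hilbert submodule. -/
def Hom.ker (f : Hom G U V) : Sub G U where
  carrier := LinearMap.ker (f.toCLM : U →ₗ[ℂ] V)
  isClosed := f.toCLM.isClosed_ker
  rep_mem g x hx := by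
    have hx' : f.toCLM x = 0 := hx
    change f.toCLM (rep g x) = 0
    rw [f.map_rep, hx', map_zero]

/-- The spectral density function `F(f)(t) = sup {dim L}`, over all Hilbert submodules `L` of `U`
such that `‖f x‖ ≤ t * ‖x‖` for all `x ∈ L`. It vanishes for `t < 0`. -/
def Hom.specDensity (f : Hom G U V) (t : ℝ) : ℝ≥0∞ :=
  ⨆ (L : Sub G U) (_ : ∀ x ∈ L.carrier, ‖f.toCLM x‖ ≤ t * ‖x‖), vnDim G L.carrier

lemma Hom.specDensity_mono (f : Hom G U V) : Monotone f.specDensity := fun _ _ hst =>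
  iSup_mono fun _ => iSup_mono' fun h =>
    ⟨fun x hx => (h x hx).trans (by gcongr), le_rfl⟩

variable [FiniteVNDim G U]

lemma Hom.specDensity_lt_top (f : Hom G U V) (t : ℝ) : f.specDensity t < ⊤ :=
  (iSup₂_le fun L _ => vnDim_sub_le L).trans_lt FiniteVNDim.vnDim_lt_top

lemma Hom.specDensity_toReal_mono (f : Hom G U V) :
    Monotone fun t : ℝ => (f.specDensity t).toReal := fun _ t hst =>
  ENNReal.toReal_mono (f.specDensity_lt_top t).ne (f.specDensity_mono hst)

/-- The Lebesgue-Stieltjes measure `dF(f)`, with `dF(f) (a, b] = F(f)(b) - F(f)(a)`. (The spectral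
density function is right-continuous, so it agrees with the right limits used here.) -/
def Hom.specMeasure (f : Hom G U V) : Measure ℝ :=
  f.specDensity_toReal_mono.stieltjesFunction.measure

open Classical in
/-- The Fuglede-Kadison determinant: `exp (∫_{0+}^∞ ln t dF(f)(t))` if the integral is `> -∞`, and
`0` otherwise. The measure `dF(f)` is finite and carried by `[0, ‖f‖]`, so that the positive part
of `ln` is always integrable and the integral is `> -∞` exactly when `ln` is integrable. -/
def Hom.det (f : Hom G U V) : ℝ :=
  if IntegrableOn Real.log (Set.Ioi 0) f.specMeasure then
    Real.exp (∫ t in Set.Ioi 0, Real.log t ∂f.specMeasure)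
  else 0

end Morphisms

end HilbertModule

end

/-! If `‖g - f‖ ≤ ε`, every `L` admissible for `F(f)(t)` is admissible for `F(g)(t + ε)`, so the
spectral density functions of `f n` and `f₀` agree up to small shifts of the argument
(`Hom.specDensity_le_add`).

For kernels it remains to see that `F(f₀)(t)` falls to `dim ker f₀` as `t → 0+`
(`Hom.exists_specDensity_lt`). The mean ergodic theorem replaces the spectral theorem: Cesàro
averages `A` of the powers of the contraction `1 - c⁻¹ f† f` converge strongly to the projection
onto `ker f`. If `‖f x‖ ≤ t ‖x‖` on `L`, the `n`-th average is bounded below there by `1 - n t`, so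
`(1 - n t)² dim L ≤ tr (A† A)`, and finite dimension makes these traces converge to `dim ker f`.

The determinant is the infimum over `k` of `exp ∫ max (ln t) (-k)` (`logDet_le`,
`exists_exp_lt_of_logDet_lt`). Each truncated integral is `∫ (ln t + k)⁺` minus `k` times the mass
of `(0, ∞)`. Shifted tail inequalities bound the first term above and the mass below, which gives
upper semicontinuity (`eventually_logDet_le`). -/

namespace HilbertModule

/-! ### The von Neumann trace and its trace property. -/

section Trace

variable {G : Type v} [Group G] {U : Type u} [NormedAddCommGroup U] [InnerProductSpace ℂ U]
  [CompleteSpace U] [HilbertModule G U]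

/-- The vector `j† (b_i ⊗ e)` of `U`; the trace of an equivariant operator `T` on `U` is
`∑ i, ⟨T v_i, v_i⟩` for these vectors `v_i`. -/
noncomputable def Embedding.vec {ι : Type u} (j : Embedding G U ι) (i : ι) : U :=
  ContinuousLinearMap.adjoint j.toIso.toContinuousLinearMap (unitVec G i)

/-- The squared Hilbert-Schmidt norm `tr (T† T)` of an operator. -/
noncomputable def Embedding.hsSq {ι : Type u} (j : Embedding G U ι) (T : U →L[ℂ] U) : ℝ≥0∞ :=
  ∑' i, ENNReal.ofReal (‖T (j.vec i)‖ ^ 2)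

lemma Embedding.toIso_apply {ι : Type u} (j : Embedding G U ι) (x : U) (i : ι) (g : G) :
    j.toIso x (i, g) = inner ℂ (j.vec i) (rep g⁻¹ x) := by
  rw [Embedding.vec, ContinuousLinearMap.adjoint_inner_left]
  have := inner_unitVec i (j.toIso (rep g⁻¹ x))
  rw [j.map_rep] at this
  simpa using this.symm

lemma inner_rep_rep (g : G) (x y : U) : inner ℂ (rep g x) (rep g y) = inner ℂ x y :=
  LinearIsometryEquiv.inner_map_map (rep g : U ≃ₗᵢ[ℂ] U) x y

lemma inner_rep_left (g : G) (x y : U) : inner ℂ (rep g x) y = inner ℂ x (rep g⁻¹ y) := by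
  rw [← inner_rep_rep g x, rep_inv_rep]

/-- Both sides are the modulus of `⟨v_b, g⁻¹ T v_a⟩`, because `T` commutes with the action. Summing
over `a`, `b` and `g` makes the Hilbert-Schmidt norm symmetric under adjoints. -/
lemma Embedding.norm_coeff_adjoint {ι : Type u} (j : Embedding G U ι) {T : U →L[ℂ] U}
    (hT : ∀ (g : G) (x : U), T (rep g x) = rep g (T x)) (a b : ι) (g : G) :
    ‖j.toIso (T (j.vec a)) (b, g)‖ =
      ‖j.toIso (ContinuousLinearMap.adjoint T (j.vec b)) (a, g⁻¹)‖ := by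
  rw [j.toIso_apply, j.toIso_apply, ← hT, ← ContinuousLinearMap.adjoint_inner_left,
    ← inner_rep_left, norm_inner_symm, inv_inv]

/-- The trace property `tr (T† T) = tr (T T†)` for equivariant `T`. -/
lemma Embedding.hsSq_adjoint {ι : Type u} (j : Embedding G U ι) {T : U →L[ℂ] U}
    (hT : ∀ (g : G) (x : U), T (rep g x) = rep g (T x)) :
    j.hsSq (ContinuousLinearMap.adjoint T) = j.hsSq T := by
  symm
  calc j.hsSq T = ∑' a : ι, ∑' b : ι, ∑' g : G,
          ENNReal.ofReal (‖j.toIso (T (j.vec a)) (b, g)‖ ^ 2) := by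
        unfold Embedding.hsSq
        congr 1; funext a
        rw [← ENNReal.tsum_prod, ← j.toIso.norm_map, enorm_sq_eq_tsum]
    _ = ∑' b : ι, ∑' a : ι, ∑' g : G, ENNReal.ofReal
          (‖j.toIso (ContinuousLinearMap.adjoint T (j.vec b)) (a, g)‖ ^ 2) := by
        rw [ENNReal.tsum_comm]
        congr 1; funext b; congr 1; funext a
        rw [← (Equiv.inv G).tsum_eq]
        congr 1; funext g
        rw [j.norm_coeff_adjoint hT]; simp
    _ = _ := by
        unfold Embedding.hsSq
        congr 1; funext b
        rw [← ENNReal.tsum_prod, ← j.toIso.norm_map, enorm_sq_eq_tsum]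

lemma Embedding.hsSq_mono {ι : Type u} (j : Embedding G U ι) {S T : U →L[ℂ] U}
    (h : ∀ x, ‖S x‖ ≤ ‖T x‖) : j.hsSq S ≤ j.hsSq T :=
  ENNReal.tsum_le_tsum fun i => ENNReal.ofReal_le_ofReal (by gcongr; exact h _)

lemma Embedding.hsSq_one {ι : Type u} (j : Embedding G U ι) : j.hsSq 1 = vnDim G U := by
  rw [vnDim_eq j, j.trace_eq]; rfl

lemma Sub.starProjection_rep (L : Sub G U) (g : G) (x : U) :
    L.carrier.starProjection (rep g x) = rep g (L.carrier.starProjection x) := by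
  refine Submodule.eq_starProjection_of_mem_of_inner_eq_zero
    (L.rep_mem g _ (Submodule.starProjection_apply_mem _ _)) fun w hw => ?_
  rw [← map_sub, inner_rep_left]
  exact Submodule.starProjection_inner_eq_zero _ _ (L.rep_mem _ _ hw)

/-- The embedding of a Hilbert submodule induced by an embedding of the module. -/
noncomputable def Embedding.restrict {ι : Type u} (j : Embedding G U ι) (L : Sub G U) :
    Embedding G L.carrier ι where
  toIso := j.toIso.comp L.carrier.subtypeₗᵢ
  map_rep g x i h := j.map_rep g x.1 i h

/-- The adjoint of the restricted embedding sends `b_i ⊗ e` to the projection of `v_i`, so the sums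
agree term by term. All submodules can thus be measured in one embedding of `U`. -/
lemma Embedding.hsSq_starProjection {ι : Type u} (j : Embedding G U ι) (L : Sub G U) :
    j.hsSq L.carrier.starProjection = vnDim G L.carrier := by
  rw [vnDim_eq (j.restrict L), Embedding.trace_eq]
  unfold Embedding.hsSq
  congr 1; funext i
  have h : (j.restrict L).toIso.toContinuousLinearMap =
      j.toIso.toContinuousLinearMap ∘L L.carrier.subtypeL := rfl
  rw [h, ContinuousLinearMap.adjoint_comp, ContinuousLinearMap.comp_apply,
    Submodule.adjoint_subtypeL]
  rfl

/-- If an equivariant operator `T` is bounded below by `c` on `L`, then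
`c ^ 2 * dim L ≤ tr (T† T)`. -/
lemma Embedding.mul_vnDim_le_hsSq {ι : Type u} (j : Embedding G U ι) (L : Sub G U)
    {T : U →L[ℂ] U} (hT : ∀ (g : G) (x : U), T (rep g x) = rep g (T x)) {c : ℝ} (hc : 0 ≤ c)
    (h : ∀ x ∈ L.carrier, c * ‖x‖ ≤ ‖T x‖) :
    ENNReal.ofReal (c ^ 2) * vnDim G L.carrier ≤ j.hsSq T := by
  set P := L.carrier.starProjection
  have hP : ContinuousLinearMap.adjoint P = P := isSelfAdjoint_starProjection L.carrier
  have hTP : ∀ (g : G) (x : U), (T ∘L P) (rep g x) = rep g ((T ∘L P) x) := fun g x => by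
    simp only [ContinuousLinearMap.comp_apply]
    rw [L.starProjection_rep, hT]
  calc ENNReal.ofReal (c ^ 2) * vnDim G L.carrier
      = ∑' i, ENNReal.ofReal ((c * ‖P (j.vec i)‖) ^ 2) := by
        rw [← j.hsSq_starProjection, Embedding.hsSq, ← ENNReal.tsum_mul_left]
        congr 1; funext i
        rw [mul_pow, ENNReal.ofReal_mul (by positivity)]
    _ ≤ j.hsSq (T ∘L P) := ENNReal.tsum_le_tsum fun i => ENNReal.ofReal_le_ofReal <| by
        gcongr
        exact h _ (Submodule.starProjection_apply_mem _ _)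
    -- `‖T P v‖ ≤ ‖T v‖` may fail for a single vector; the trace property puts `P` on the outside,
    -- where it only shrinks norms.
    _ = j.hsSq (P ∘L ContinuousLinearMap.adjoint T) := by
        rw [← j.hsSq_adjoint hTP, ContinuousLinearMap.adjoint_comp, hP]
    _ ≤ j.hsSq (ContinuousLinearMap.adjoint T) := j.hsSq_mono fun x =>
        L.carrier.norm_starProjection_apply_le _
    _ = j.hsSq T := j.hsSq_adjoint hT

/-- Dominated convergence for the Hilbert-Schmidt norm of contractions. -/
lemma Embedding.tendsto_hsSq [FiniteVNDim G U] {ι : Type u} (j : Embedding G U ι)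
    {T : ℕ → U →L[ℂ] U} {S : U →L[ℂ] U} (hT : ∀ n x, ‖T n x‖ ≤ ‖x‖)
    (hS : ∀ x, Tendsto (fun n => T n x) atTop (𝓝 (S x))) :
    Tendsto (fun n => j.hsSq (T n)) atTop (𝓝 (j.hsSq S)) := by
  -- The dominating family is `‖v_i‖²`, whose sum is `dim U`.
  have hfin : j.hsSq 1 ≠ ⊤ := by
    rw [j.hsSq_one]; exact FiniteVNDim.vnDim_lt_top.ne
  let _ : MeasurableSpace ι := ⊤
  simp only [Embedding.hsSq, ← lintegral_count] at hfin ⊢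
  refine tendsto_lintegral_of_dominated_convergence _ (fun _ => measurable_from_top)
    (fun n => ae_of_all _ fun i => ENNReal.ofReal_le_ofReal ?_) hfin
    (ae_of_all _ fun i => ENNReal.tendsto_ofReal ((hS _).norm.pow 2))
  gcongr
  exact hT _ _

end Trace

/-! ### Cesàro averages and the mean ergodic theorem. -/

section Averages

variable {𝕜 E F : Type*} [RCLike 𝕜] [NormedAddCommGroup E] [InnerProductSpace 𝕜 E]
  [NormedAddCommGroup F] [InnerProductSpace 𝕜 F]

/-- The Cesàro averages of the powers of an operator. -/
def cesaro (B : E →L[𝕜] E) (n : ℕ) : E →L[𝕜] E :=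
  ((n : 𝕜)⁻¹) • ∑ k ∈ Finset.range n, B ^ k

lemma cesaro_apply (B : E →L[𝕜] E) (n : ℕ) (x : E) :
    cesaro B n x = birkhoffAverage 𝕜 B _root_.id n x := by
  simp [cesaro, birkhoffAverage, birkhoffSum]

lemma norm_pow_apply_le_of_norm_apply_le {B : E →L[𝕜] E} (hB : ∀ x, ‖B x‖ ≤ ‖x‖) (k : ℕ)
    (x : E) : ‖(B ^ k) x‖ ≤ ‖x‖ := by
  induction k with
  | zero => simp
  | succ k ih =>
    rw [pow_succ']
    exact (hB _).trans ih

lemma norm_cesaro_apply_le {B : E →L[𝕜] E} (hB : ∀ x, ‖B x‖ ≤ ‖x‖) (n : ℕ) (x : E) :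
    ‖cesaro B n x‖ ≤ ‖x‖ := by
  rcases Nat.eq_zero_or_pos n with rfl | hn
  · simp [cesaro]
  have hn' : (0 : ℝ) < n := by exact_mod_cast hn
  simp only [cesaro, smul_apply, sum_apply, norm_smul,
    norm_inv, RCLike.norm_natCast]
  rw [inv_mul_le_iff₀ hn']
  refine (norm_sum_le_of_le _ fun k _ => norm_pow_apply_le_of_norm_apply_le hB k x).trans ?_
  simp

lemma norm_sub_pow_apply_le {B : E →L[𝕜] E} (hB : ∀ x, ‖B x‖ ≤ ‖x‖) (k : ℕ) (x : E) :
    ‖x - (B ^ k) x‖ ≤ k * ‖x - B x‖ := by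
  induction k with
  | zero => simp
  | succ k ih =>
    have e : x - (B ^ (k + 1)) x = (x - (B ^ k) x) + (B ^ k) (x - B x) := by
      rw [map_sub, pow_succ]
      simp
    rw [e]
    refine (norm_add_le _ _).trans ?_
    have := norm_pow_apply_le_of_norm_apply_le hB k (x - B x)
    rw [Nat.cast_succ]
    linarith

lemma norm_sub_cesaro_apply_le {B : E →L[𝕜] E} (hB : ∀ x, ‖B x‖ ≤ ‖x‖) {n : ℕ} (hn : 0 < n)
    (x : E) : ‖x - cesaro B n x‖ ≤ n * ‖x - B x‖ := by
  have hn' : (0 : ℝ) < n := by exact_mod_cast hn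
  have hn'' : (n : 𝕜) ≠ 0 := by exact_mod_cast hn.ne'
  have e : x - cesaro B n x = (n : 𝕜)⁻¹ • ∑ k ∈ Finset.range n, (x - (B ^ k) x) := by
    rw [Finset.sum_sub_distrib, smul_sub, Finset.sum_const, Finset.card_range,
      ← Nat.cast_smul_eq_nsmul 𝕜, inv_smul_smul₀ hn'']
    simp [cesaro]
  rw [e, norm_smul, norm_inv, RCLike.norm_natCast, inv_mul_le_iff₀ hn']
  refine (norm_sum_le_of_le (f := fun k => x - (B ^ k) x) _
    (n := fun _ => n * ‖x - B x‖) fun k hk => ?_).trans (by simp)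
  refine (norm_sub_pow_apply_le hB k x).trans ?_
  gcongr
  exact (Finset.mem_range.1 hk).le

variable [CompleteSpace E] [CompleteSpace F]

/-- The operator `1 - (‖f‖² + 1)⁻¹ f† f`. -/
noncomputable def oneSubGram (f : E →L[𝕜] F) : E →L[𝕜] E :=
  1 - (((‖f‖ ^ 2 + 1 : ℝ) : 𝕜)⁻¹) • (ContinuousLinearMap.adjoint f ∘L f)

lemma oneSubGram_apply (f : E →L[𝕜] F) (x : E) :
    oneSubGram f x = x - ((‖f‖ ^ 2 + 1 : ℝ) : 𝕜)⁻¹ • ContinuousLinearMap.adjoint f (f x) := by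
  simp [oneSubGram]

lemma norm_adjoint_apply_le (f : E →L[𝕜] F) (y : F) :
    ‖ContinuousLinearMap.adjoint f y‖ ≤ ‖f‖ * ‖y‖ := by
  simpa using (ContinuousLinearMap.adjoint f).le_opNorm y

/-- With `c = ‖f‖² + 1`, expanding the square gives the cross term `-2 c⁻¹ ‖f x‖²`, while the
quadratic term is at most `c⁻¹ ‖f x‖²`. -/
lemma norm_oneSubGram_apply_le (f : E →L[𝕜] F) (x : E) : ‖oneSubGram f x‖ ≤ ‖x‖ := by
  set c : ℝ := ‖f‖ ^ 2 + 1 with hc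
  have hc0 : 0 < c := by positivity
  set y := ContinuousLinearMap.adjoint f (f x) with hy
  have h1 : RCLike.re (inner 𝕜 x (((c : 𝕜)⁻¹) • y)) = c⁻¹ * ‖f x‖ ^ 2 := by
    rw [inner_smul_right, hy, ContinuousLinearMap.adjoint_inner_right, inner_self_eq_norm_sq_to_K]
    rw [← RCLike.ofReal_inv, ← RCLike.ofReal_pow, ← RCLike.ofReal_mul, RCLike.ofReal_re]
  have h2 : ‖((c : 𝕜)⁻¹) • y‖ = c⁻¹ * ‖y‖ := by
    rw [norm_smul, norm_inv, RCLike.norm_ofReal, abs_of_pos hc0]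
  have h3 : ‖y‖ ^ 2 ≤ c * ‖f x‖ ^ 2 := by
    calc ‖y‖ ^ 2 ≤ (‖f‖ * ‖f x‖) ^ 2 := by gcongr; exact norm_adjoint_apply_le f _
      _ ≤ c * ‖f x‖ ^ 2 := by rw [mul_pow]; gcongr; simp [hc]
  have h4 : ‖oneSubGram f x‖ ^ 2 ≤ ‖x‖ ^ 2 := by
    rw [oneSubGram_apply, norm_sub_sq (𝕜 := 𝕜), h1, h2, mul_pow]
    have : c⁻¹ ^ 2 * ‖y‖ ^ 2 ≤ c⁻¹ ^ 2 * (c * ‖f x‖ ^ 2) := by gcongr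
    have e : c⁻¹ ^ 2 * (c * ‖f x‖ ^ 2) = c⁻¹ * ‖f x‖ ^ 2 := by field_simp
    have : 0 ≤ c⁻¹ * ‖f x‖ ^ 2 := by positivity
    linarith
  exact (pow_le_pow_iff_left₀ (norm_nonneg _) (norm_nonneg _) two_ne_zero).1 h4

/-- The normalisation `‖f‖² + 1` is nonzero even for `f = 0` and dominates `‖f‖`, so no constant
appears. -/
lemma norm_sub_oneSubGram_apply_le (f : E →L[𝕜] F) (x : E) :
    ‖x - oneSubGram f x‖ ≤ ‖f x‖ := by
  have hc0 : (0 : ℝ) < ‖f‖ ^ 2 + 1 := by positivity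
  rw [oneSubGram_apply, sub_sub_cancel, norm_smul, norm_inv, RCLike.norm_ofReal, abs_of_pos hc0,
    inv_mul_le_iff₀ hc0]
  refine (norm_adjoint_apply_le f _).trans ?_
  gcongr
  nlinarith [sq_nonneg (‖f‖ - 1), sq_nonneg ‖f‖]

/-- A fixed vector satisfies `f† f x = 0`, hence `‖f x‖² = ⟨f x, f x⟩ = 0`. -/
lemma eqLocus_oneSubGram (f : E →L[𝕜] F) :
    (oneSubGram f).eqLocus (1 : E →L[𝕜] E) = LinearMap.ker (f : E →ₗ[𝕜] F) := by
  ext x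
  have hc0 : ((‖f‖ ^ 2 + 1 : ℝ) : 𝕜) ≠ 0 := by
    rw [Ne, RCLike.ofReal_eq_zero]; positivity
  change oneSubGram f x = x ↔ f x = 0
  rw [oneSubGram_apply, sub_eq_self, smul_eq_zero, or_iff_right (inv_ne_zero hc0)]
  refine ⟨fun h => ?_, fun h => by simp [h]⟩
  rw [← inner_self_eq_zero (𝕜 := 𝕜), ← ContinuousLinearMap.adjoint_inner_right, h,
    inner_zero_right]

lemma tendsto_cesaro_oneSubGram (f : E →L[𝕜] F) (x : E) :
    Tendsto (fun n => cesaro (oneSubGram f) n x) atTop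
      (𝓝 ((LinearMap.ker (f : E →ₗ[𝕜] F)).starProjection x)) := by
  have h := ContinuousLinearMap.tendsto_birkhoffAverage_orthogonalProjection (oneSubGram f)
    (ContinuousLinearMap.opNorm_le_bound _ zero_le_one fun x => by
      simpa using norm_oneSubGram_apply_le f x) x
  simp only [cesaro_apply]
  simpa only [← Submodule.starProjection_apply, eqLocus_oneSubGram] using h

end Averages

/-! ### Semicontinuity of the dimension of the kernel. -/

section Kernel

variable {G : Type v} [Group G] {U : Type u} [NormedAddCommGroup U] [InnerProductSpace ℂ U]
  [CompleteSpace U] [HilbertModule G U] {V : Type w} [NormedAddCommGroup V]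
  [InnerProductSpace ℂ V] [CompleteSpace V] [HilbertModule G V]

lemma Hom.adjoint_rep (f : Hom G U V) (g : G) (y : V) :
    ContinuousLinearMap.adjoint f.toCLM (rep g y) =
      rep g (ContinuousLinearMap.adjoint f.toCLM y) := by
  refine ext_inner_right ℂ fun x => ?_
  rw [ContinuousLinearMap.adjoint_inner_left, inner_rep_left, inner_rep_left,
    ContinuousLinearMap.adjoint_inner_left, f.map_rep]

lemma Hom.cesaro_rep (f : Hom G U V) (n : ℕ) (g : G) (x : U) :
    cesaro (oneSubGram f.toCLM) n (rep g x) = rep g (cesaro (oneSubGram f.toCLM) n x) := by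
  have h1 : ∀ x, oneSubGram f.toCLM (rep g x) = rep g (oneSubGram f.toCLM x) := fun x => by
    rw [oneSubGram_apply, oneSubGram_apply, f.map_rep, f.adjoint_rep, map_sub, map_smul]
  have h2 : ∀ (k : ℕ) x, (oneSubGram f.toCLM ^ k) (rep g x) =
      rep g ((oneSubGram f.toCLM ^ k) x) := fun k => by
    induction k with
    | zero => simp
    | succ k ih => intro x; rw [pow_succ]; simp [h1, ih]
  simp [cesaro, h2]

/-- On an admissible `L` the average moves `x` by at most `n t ‖x‖`, so it is bounded below by `1 -
n t`. -/
lemma Hom.mul_specDensity_le_hsSq (f : Hom G U V) {ι : Type u} (j : Embedding G U ι) {n : ℕ}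
    (hn : 0 < n) {t : ℝ} (ht : n * t ≤ 1) :
    ENNReal.ofReal ((1 - n * t) ^ 2) * f.specDensity t ≤
      j.hsSq (cesaro (oneSubGram f.toCLM) n) := by
  simp only [Hom.specDensity, ENNReal.mul_iSup]
  refine iSup₂_le fun L hL => j.mul_vnDim_le_hsSq L (f.cesaro_rep n) (by linarith) fun x hx => ?_
  have h1 := norm_sub_cesaro_apply_le (norm_oneSubGram_apply_le f.toCLM) hn x
  have h2 := norm_sub_oneSubGram_apply_le f.toCLM x
  have h3 := hL x hx
  have h4 := norm_sub_norm_le x (cesaro (oneSubGram f.toCLM) n x)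
  have h5 : n * ‖x - oneSubGram f.toCLM x‖ ≤ n * (t * ‖x‖) := by gcongr; exact h2.trans h3
  linarith

/-- Right-continuity of the spectral density function at `0`. -/
lemma Hom.exists_specDensity_lt [FiniteVNDim G U] (f : Hom G U V) {c : ℝ≥0∞}
    (hc : vnDim G f.ker.carrier < c) : ∃ t > 0, f.specDensity t < c := by
  obtain ⟨ι, j₀, hj₀⟩ := exists_embedding (G := G) (V := U)
  let j : Embedding G U ι := ⟨j₀, hj₀⟩
  have hlim := j.tendsto_hsSq (norm_cesaro_apply_le (norm_oneSubGram_apply_le f.toCLM))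
    (tendsto_cesaro_oneSubGram f.toCLM)
  rw [show j.hsSq (LinearMap.ker (f.toCLM : U →ₗ[ℂ] V)).starProjection = vnDim G f.ker.carrier
    from j.hsSq_starProjection f.ker] at hlim
  -- `n` is fixed before `t`: the strict inequality leaves room to divide by `(1 - n t)²` for small
  -- `t`.
  obtain ⟨n, hn, hn0⟩ := ((hlim.eventually_lt_const hc).and (eventually_gt_atTop 0)).exists
  have hn' : (0 : ℝ) < n := by exact_mod_cast hn0
  have h1 : Tendsto (fun t : ℝ => ENNReal.ofReal ((1 - n * t) ^ 2)) (𝓝[>] 0) (𝓝 1) := by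
    have : Tendsto (fun t : ℝ => ENNReal.ofReal ((1 - n * t) ^ 2)) (𝓝 0)
        (𝓝 (ENNReal.ofReal ((1 - n * 0) ^ 2))) := by
      refine ENNReal.tendsto_ofReal (Continuous.tendsto (by fun_prop) _)
    simpa using this.mono_left nhdsWithin_le_nhds
  have h2 : Tendsto (fun t : ℝ => j.hsSq (cesaro (oneSubGram f.toCLM) n) /
      ENNReal.ofReal ((1 - n * t) ^ 2)) (𝓝[>] 0)
      (𝓝 (j.hsSq (cesaro (oneSubGram f.toCLM) n))) := by
    simpa using ENNReal.Tendsto.div tendsto_const_nhds (Or.inr one_ne_zero) h1 (Or.inl (by simp))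
  have h3 : ∀ᶠ t : ℝ in 𝓝[>] 0, t < (n : ℝ)⁻¹ :=
    nhdsWithin_le_nhds (Iio_mem_nhds (by positivity))
  obtain ⟨t, ⟨ht, ht'⟩, ht0⟩ :=
    (((h2.eventually_lt_const hn).and h3).and self_mem_nhdsWithin).exists
  refine ⟨t, ht0, lt_of_le_of_lt ?_ ht⟩
  have h4 : n * t < 1 := by
    calc n * t < n * (n : ℝ)⁻¹ := by gcongr
      _ = 1 := mul_inv_cancel₀ hn'.ne'
  rw [ENNReal.le_div_iff_mul_le (Or.inl _) (Or.inl ENNReal.ofReal_ne_top), mul_comm]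
  · exact f.mul_specDensity_le_hsSq j hn0 h4.le
  · rw [Ne, ENNReal.ofReal_eq_zero, not_le]
    have : 0 < 1 - n * t := by linarith
    positivity

lemma Hom.specDensity_le_add (f g : Hom G U V) {ε : ℝ} (h : ‖g.toCLM - f.toCLM‖ ≤ ε) (t : ℝ) :
    f.specDensity t ≤ g.specDensity (t + ε) :=
  iSup_mono fun L => iSup_mono' fun hL => ⟨fun x hx => by
    have h1 := (g.toCLM - f.toCLM).le_of_opNorm_le h x
    have h2 := norm_sub_norm_le (g.toCLM x) (f.toCLM x)
    have h3 := hL x hx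
    rw [sub_apply] at h1
    linarith, le_rfl⟩

lemma Hom.vnDim_ker_le_specDensity (f : Hom G U V) {t : ℝ} (ht : 0 ≤ t) :
    vnDim G f.ker.carrier ≤ f.specDensity t :=
  le_iSup₂_of_le f.ker (fun x hx => by
    rw [show f.toCLM x = 0 from hx, norm_zero]; positivity) le_rfl

theorem limsup_vnDim_ker_le [FiniteVNDim G U] (f : ℕ → Hom G U V) (f₀ : Hom G U V)
    (hf : Tendsto (fun n => (f n).toCLM) atTop (𝓝 f₀.toCLM)) :
    limsup (fun n => vnDim G (f n).ker.carrier) atTop ≤ vnDim G f₀.ker.carrier := by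
  refine le_of_forall_gt_imp_ge_of_dense fun c hc => ?_
  obtain ⟨t, ht, htc⟩ := f₀.exists_specDensity_lt hc
  refine limsup_le_of_le (by isBoundedDefault) ?_
  filter_upwards [(tendsto_iff_norm_sub_tendsto_zero.1 hf).eventually_le_const ht] with n hn
  calc vnDim G (f n).ker.carrier ≤ (f n).specDensity 0 :=
        (f n).vnDim_ker_le_specDensity le_rfl
    _ ≤ f₀.specDensity (0 + t) := (f n).specDensity_le_add f₀ (by rwa [norm_sub_rev]) 0
    _ ≤ c := by rw [zero_add]; exact htc.le

end Kernel

/-! ### The determinant as an infimum of truncated integrals. -/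

section LogDeterminant

open Classical in
/-- The determinant `exp (∫ ln t dν)` of a measure, and `0` if the integral is not finite. -/
noncomputable def logDet (ν : Measure ℝ) : ℝ :=
  if Integrable Real.log ν then Real.exp (∫ t, Real.log t ∂ν) else 0

/-- The integral `∫ (ln t + r)⁺ dν`. -/
noncomputable def posLogIntegral (ν : Measure ℝ) (r : ℝ) : ℝ≥0∞ :=
  ∫⁻ t, ENNReal.ofReal (Real.log t + r) ∂ν

variable {ν : Measure ℝ} [IsFiniteMeasure ν] {B : ℝ}

lemma posLogIntegral_ne_top (hB : ∀ᵐ t ∂ν, Real.log t ≤ B) (r : ℝ) :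
    posLogIntegral ν r ≠ ⊤ := by
  refine ne_top_of_le_ne_top
    (ENNReal.mul_ne_top (ENNReal.ofReal_ne_top (r := B + r)) (measure_ne_top ν Set.univ)) ?_
  rw [← lintegral_const]
  exact lintegral_mono_ae (hB.mono fun t ht => ENNReal.ofReal_le_ofReal (by linarith))

lemma integrable_max_log (hB : ∀ᵐ t ∂ν, Real.log t ≤ B) (r : ℝ) :
    Integrable (fun t => max (Real.log t) (-r)) ν := by
  refine Integrable.of_bound (by fun_prop) (|B| + |r|) (hB.mono fun t ht => ?_)
  rw [Real.norm_eq_abs, abs_le]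
  constructor
  · have := le_max_right (Real.log t) (-r)
    linarith [le_abs_self r, abs_nonneg B]
  · exact max_le (by linarith [le_abs_self B, abs_nonneg r])
      (by linarith [neg_abs_le r, abs_nonneg B])

/-- This rests on `max a (-r) + r = (a + r)⁺`. It isolates the mass, which enters with a negative
sign when `r > 0` and so needs a lower bound later. -/
lemma integral_max_log (hB : ∀ᵐ t ∂ν, Real.log t ≤ B) (r : ℝ) :
    ∫ t, max (Real.log t) (-r) ∂ν = (posLogIntegral ν r).toReal - r * ν.real Set.univ := by
  have hI : Integrable (fun t => max (Real.log t) (-r) + r) ν :=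
    (integrable_max_log hB r).add (integrable_const r)
  have h1 : posLogIntegral ν r = ENNReal.ofReal (∫ t, (max (Real.log t) (-r) + r) ∂ν) := by
    rw [ofReal_integral_eq_lintegral_ofReal hI
      (ae_of_all _ fun t => by have := le_max_right (Real.log t) (-r); simp; linarith)]
    refine lintegral_congr fun t => ?_
    rw [max_add, neg_add_cancel, ENNReal.ofReal_max, ENNReal.ofReal_zero, max_eq_left zero_le]
  have h2 : 0 ≤ ∫ t, (max (Real.log t) (-r) + r) ∂ν :=
    integral_nonneg fun t => by have := le_max_right (Real.log t) (-r); simp; linarith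
  rw [h1, ENNReal.toReal_ofReal h2, integral_add (integrable_max_log hB r) (integrable_const r),
    integral_const, smul_eq_mul]
  ring

lemma logDet_le (hB : ∀ᵐ t ∂ν, Real.log t ≤ B) (r : ℝ) :
    logDet ν ≤ Real.exp ((posLogIntegral ν r).toReal - r * ν.real Set.univ) := by
  unfold logDet
  split_ifs with h
  · rw [← integral_max_log hB r, Real.exp_le_exp]
    exact integral_mono h (integrable_max_log hB r) fun t => le_max_left _ _
  · positivity

lemma logDet_nonneg (ν : Measure ℝ) : 0 ≤ logDet ν := by
  unfold logDet
  split_ifs <;> positivity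

lemma tendsto_max_neg_natCast (a : ℝ) :
    Tendsto (fun k : ℕ => max a (-(k : ℝ))) atTop (𝓝 a) := by
  refine tendsto_const_nhds.congr' ?_
  filter_upwards [(tendsto_natCast_atTop_atTop (R := ℝ)).eventually_ge_atTop (-a)] with k hk
  rw [max_eq_left (by linarith)]

/-- Monotone convergence for `C - max (ln t) (-k)`: a uniform lower bound on the truncated integrals
excludes divergence to `-∞`. -/
lemma integrable_log_of_le_integral_max (hB : ∀ᵐ t ∂ν, Real.log t ≤ B) {a : ℝ}
    (ha : ∀ k : ℕ, a ≤ ∫ t, max (Real.log t) (-(k : ℝ)) ∂ν) : Integrable Real.log ν := by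
  -- `B` itself may be negative, whereas the truncation at `k = 0` is nonnegative.
  set C := |B|
  have hC : ∀ᵐ t ∂ν, ∀ k : ℕ, 0 ≤ C - max (Real.log t) (-(k : ℝ)) := by
    filter_upwards [hB] with t ht k
    have : max (Real.log t) (-(k : ℝ)) ≤ C := max_le (ht.trans (le_abs_self B))
      ((neg_nonpos.2 k.cast_nonneg).trans (abs_nonneg B))
    linarith
  have hint : ∀ k : ℕ, Integrable (fun t => C - max (Real.log t) (-(k : ℝ))) ν := fun k =>
    (integrable_const C).sub (integrable_max_log hB k)
  have hlim : Tendsto (fun k : ℕ => ∫⁻ t, ENNReal.ofReal (C - max (Real.log t) (-(k : ℝ))) ∂ν)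
      atTop (𝓝 (∫⁻ t, ENNReal.ofReal (C - Real.log t) ∂ν)) := by
    refine lintegral_tendsto_of_tendsto_of_monotone (fun k => by fun_prop)
      (ae_of_all _ fun t k l hkl => ENNReal.ofReal_le_ofReal ?_)
      (ae_of_all _ fun t => ENNReal.tendsto_ofReal ((tendsto_max_neg_natCast _).const_sub C))
    gcongr
  have hle : ∫⁻ t, ENNReal.ofReal (C - Real.log t) ∂ν ≤
      ENNReal.ofReal (C * ν.real Set.univ - a) := by
    refine le_of_tendsto' hlim fun k => ?_
    rw [← ofReal_integral_eq_lintegral_ofReal (hint k) (hC.mono fun t ht => ht k),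
      integral_sub (integrable_const C) (integrable_max_log hB k), integral_const, smul_eq_mul]
    exact ENNReal.ofReal_le_ofReal (by linarith [ha k, mul_comm C (ν.real Set.univ)])
  have hI : Integrable (fun t => C - Real.log t) ν := by
    refine ⟨by fun_prop, ?_⟩
    rw [hasFiniteIntegral_iff_ofReal (hB.mono fun t ht => ?_)]
    · exact hle.trans_lt ENNReal.ofReal_lt_top
    · have := le_abs_self B
      simp only [Pi.zero_apply]
      linarith
  simpa [Pi.sub_def] using (integrable_const C).sub hI

/-- If every truncation stayed at or above `c > 0`, then `ln` would be integrable and dominated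
convergence would give `logDet ν ≥ c`. This also covers the case of determinant `0`. -/
lemma exists_exp_lt_of_logDet_lt (hB : ∀ᵐ t ∂ν, Real.log t ≤ B) {c : ℝ} (hc : logDet ν < c) :
    ∃ k : ℕ, Real.exp ((posLogIntegral ν k).toReal - k * ν.real Set.univ) < c := by
  have hc0 : 0 < c := (logDet_nonneg ν).trans_lt hc
  by_contra! hcon
  simp only [← integral_max_log hB] at hcon
  have hlog : Integrable Real.log ν := integrable_log_of_le_integral_max hB (a := Real.log c)
    fun k => (Real.log_le_iff_le_exp hc0).2 (hcon k)
  have hlim : Tendsto (fun k : ℕ => ∫ t, max (Real.log t) (-(k : ℝ)) ∂ν) atTop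
      (𝓝 (∫ t, Real.log t ∂ν)) := by
    refine tendsto_integral_of_dominated_convergence (fun t => |Real.log t|)
      (fun k => by fun_prop) hlog.abs (fun k => ae_of_all _ fun t => ?_)
      (ae_of_all _ fun t => tendsto_max_neg_natCast _)
    have hk : (0 : ℝ) ≤ k := k.cast_nonneg
    rw [Real.norm_eq_abs, abs_le]
    exact ⟨(neg_abs_le _).trans (le_max_left _ _),
      max_le (le_abs_self _) (by linarith [abs_nonneg (Real.log t)])⟩
  have := ge_of_tendsto' ((Real.continuous_exp.tendsto _).comp hlim) hcon
  rw [logDet, if_pos hlog] at hc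
  exact absurd hc this.not_gt

end LogDeterminant

/-! ### Comparing determinants through tails of measures. -/

section Comparison

/-- Layer cake formula for `∫ (ln t + r)⁺`. -/
lemma posLogIntegral_restrict_Ioi (μ : Measure ℝ) (r : ℝ) :
    posLogIntegral (μ.restrict (Set.Ioi 0)) r =
      ∫⁻ s in Set.Ioi 0, μ (Set.Ioi (Real.exp (s - r))) := by
  have h := lintegral_eq_lintegral_meas_lt (μ.restrict (Set.Ioi 0))
    (f := fun t => max (Real.log t + r) 0) (ae_of_all _ fun t => le_max_right _ _) (by fun_prop)
  simp only [ENNReal.ofReal_max, ENNReal.ofReal_zero,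
      max_eq_left zero_le] at h
  rw [posLogIntegral, h]
  refine setLIntegral_congr_fun measurableSet_Ioi fun s (hs : 0 < s) => ?_
  rw [Measure.restrict_apply (measurableSet_lt (by fun_prop) (by fun_prop))]
  congr 1
  ext t
  simp only [Set.mem_inter_iff, Set.mem_ofPred_eq, Set.mem_Ioi, lt_max_iff, hs.not_gt, or_false]
  constructor
  · rintro ⟨h1, h2⟩
    rw [← Real.lt_log_iff_exp_lt h2]
    linarith
  · intro h1
    have h2 : 0 < t := (Real.exp_pos _).trans h1
    rw [← Real.lt_log_iff_exp_lt h2] at h1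
    exact ⟨by linarith, h2⟩

lemma posLogIntegral_add_le (ν : Measure ℝ) (r : ℝ) (θ : ℝ) :
    posLogIntegral ν (r + θ) ≤ posLogIntegral ν r + ENNReal.ofReal θ * ν Set.univ := by
  rw [posLogIntegral, posLogIntegral, ← lintegral_const, ← lintegral_add_right _ (by fun_prop)]
  refine lintegral_mono fun t => ?_
  rw [← add_assoc]
  exact ENNReal.ofReal_add_le

/-- The layer cake formula uses only tails at thresholds `exp (s - r)` above `exp (-r)`. There,
lowering the threshold by the factor `exp (-θ)` lowers it by at least the permitted additive shift,
so that shift costs at most `θ` in the logarithm. -/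
lemma posLogIntegral_le_of_measure_Ioi_le {μ μ' : Measure ℝ} {r θ : ℝ}
    (h : ∀ x, μ' (Set.Ioi (x + Real.exp (-r) * (1 - Real.exp (-θ)))) ≤ μ (Set.Ioi x))
    (hθ : 0 ≤ θ) :
    posLogIntegral (μ'.restrict (Set.Ioi 0)) r ≤
      posLogIntegral (μ.restrict (Set.Ioi 0)) r + ENNReal.ofReal θ * μ (Set.Ioi 0) := by
  have h1 : posLogIntegral (μ'.restrict (Set.Ioi 0)) r ≤
      posLogIntegral (μ.restrict (Set.Ioi 0)) (r + θ) := by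
    rw [posLogIntegral_restrict_Ioi, posLogIntegral_restrict_Ioi]
    refine setLIntegral_mono' measurableSet_Ioi fun s (hs : 0 < s) =>
      (measure_mono (Set.Ioi_subset_Ioi ?_)).trans (h _)
    have e1 : Real.exp (s - (r + θ)) = Real.exp (s - r) * Real.exp (-θ) := by
      rw [← Real.exp_add]; ring_nf
    have e2 : Real.exp (-r) ≤ Real.exp (s - r) := Real.exp_le_exp.2 (by linarith)
    have e3 : Real.exp (-θ) ≤ 1 := Real.exp_le_one_iff.2 (by linarith)
    rw [e1]
    nlinarith
  simpa using h1.trans (posLogIntegral_add_le _ r θ)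

lemma ae_log_le_of_measure_Ioi_eq_zero {μ : Measure ℝ} {M : ℝ} (hM : μ (Set.Ioi M) = 0) :
    ∀ᵐ t ∂μ.restrict (Set.Ioi 0), Real.log t ≤ Real.log M := by
  rw [ae_restrict_iff' measurableSet_Ioi]
  filter_upwards [compl_mem_ae_iff.2 hM] with t ht h0
  exact Real.log_le_log h0 (not_lt.1 ht)

lemma exists_measure_Ioi_gt {μ : Measure ℝ} {b : ℝ≥0∞} (hb : b < μ (Set.Ioi 0)) :
    ∃ x > 0, b < μ (Set.Ioi x) := by
  have hU : ⋃ n : ℕ, Set.Ioi ((n : ℝ) + 1)⁻¹ = Set.Ioi (0 : ℝ) := by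
    ext t
    simp only [Set.mem_iUnion, Set.mem_Ioi]
    refine ⟨fun ⟨n, hn⟩ => lt_trans (by positivity) hn, fun ht => ?_⟩
    simpa only [one_div] using exists_nat_one_div_lt ht
  have hmono : Monotone fun n : ℕ => Set.Ioi ((n : ℝ) + 1)⁻¹ := fun m n hmn =>
    Set.Ioi_subset_Ioi (by gcongr)
  have hlim := tendsto_measure_iUnion_atTop (μ := μ) hmono
  rw [hU] at hlim
  obtain ⟨n, hn⟩ := (hlim.eventually_const_lt hb).exists
  exact ⟨_, by positivity, hn⟩

/-- Upper semicontinuity of the determinant of measures whose tails converge up to small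
translations of the argument. -/
theorem eventually_logDet_le {μ : ℕ → Measure ℝ} {μ₀ : Measure ℝ}
    (hfin : ∀ n, μ n (Set.Ioi 0) ≠ ⊤) (hfin₀ : μ₀ (Set.Ioi 0) ≠ ⊤)
    (hM : ∀ n, ∃ M, μ n (Set.Ioi M) = 0) (hM₀ : ∃ M, μ₀ (Set.Ioi M) = 0)
    (hle : ∀ ε > 0, ∀ᶠ n in atTop, ∀ x, μ n (Set.Ioi (x + ε)) ≤ μ₀ (Set.Ioi x))
    (hge : ∀ ε > 0, ∀ᶠ n in atTop, ∀ x, μ₀ (Set.Ioi (x + ε)) ≤ μ n (Set.Ioi x))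
    {c : ℝ} (hc : logDet (μ₀.restrict (Set.Ioi 0)) < c) :
    ∀ᶠ n in atTop, logDet ((μ n).restrict (Set.Ioi 0)) ≤ c := by
  have hF : ∀ n, IsFiniteMeasure ((μ n).restrict (Set.Ioi 0)) := fun n =>
    isFiniteMeasure_restrict.2 (hfin n)
  have hF₀ : IsFiniteMeasure (μ₀.restrict (Set.Ioi 0)) := isFiniteMeasure_restrict.2 hfin₀
  obtain ⟨M₀, hM₀⟩ := hM₀
  have hB₀ := ae_log_le_of_measure_Ioi_eq_zero hM₀
  obtain ⟨k, hk⟩ := exists_exp_lt_of_logDet_lt hB₀ hc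
  rw [measureReal_restrict_apply_univ] at hk
  set m := μ₀.real (Set.Ioi 0)
  set Λ := (posLogIntegral (μ₀.restrict (Set.Ioi 0)) k).toReal
  -- The slack `θ` is spent twice: on the shift of the logarithm, costing `θ * m`, and on a possible
  -- loss of mass.
  obtain ⟨θ, hθc, hθ⟩ : ∃ θ : ℝ, Real.exp (Λ + θ * m - k * (m - θ)) < c ∧ 0 < θ := by
    have hcont : Tendsto (fun θ : ℝ => Real.exp (Λ + θ * m - k * (m - θ))) (𝓝[>] 0)
        (𝓝 (Real.exp (Λ + 0 * m - k * (m - 0)))) :=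
      (Continuous.tendsto (by fun_prop) 0).mono_left nhdsWithin_le_nhds
    refine ((hcont.eventually_lt_const (by simpa using hk)).and self_mem_nhdsWithin).exists
  have hε : 0 < Real.exp (-(k : ℝ)) * (1 - Real.exp (-θ)) := by
    have : Real.exp (-θ) < 1 := Real.exp_lt_one_iff.2 (by linarith)
    have := Real.exp_pos (-(k : ℝ))
    apply mul_pos <;> linarith
  -- `hge` compares tails only after a positive shift, so the mass of `μ n` on `(0, ∞)` is bounded
  -- below by that of `μ₀` on `(x, ∞)`, where `x` discards at most `θ`.
  obtain ⟨x, hx, hxm⟩ : ∃ x > 0, m - θ ≤ μ₀.real (Set.Ioi x) := by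
    rcases le_or_gt m θ with h | h
    · exact ⟨1, one_pos, (sub_nonpos.2 h).trans measureReal_nonneg⟩
    · obtain ⟨x, hx, hlt⟩ := exists_measure_Ioi_gt (μ := μ₀) (b := ENNReal.ofReal (m - θ))
        ((ENNReal.ofReal_lt_iff_lt_toReal (by linarith) hfin₀).2
          (show m - θ < m by linarith))
      refine ⟨x, hx, (ENNReal.ofReal_le_iff_le_toReal ?_).1 hlt.le⟩
      exact ne_top_of_le_ne_top hfin₀ (measure_mono (Set.Ioi_subset_Ioi hx.le))
  filter_upwards [hle _ hε, hge x hx] with n hn1 hn2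
  obtain ⟨M, hM⟩ := hM n
  refine (logDet_le (ae_log_le_of_measure_Ioi_eq_zero hM) k).trans (le_trans ?_ hθc.le)
  rw [Real.exp_le_exp, measureReal_restrict_apply_univ]
  have h1 : (posLogIntegral ((μ n).restrict (Set.Ioi 0)) k).toReal ≤ Λ + θ * m := by
    have h := posLogIntegral_le_of_measure_Ioi_le hn1 hθ.le
    have ht1 := posLogIntegral_ne_top hB₀ k
    have ht2 : ENNReal.ofReal θ * μ₀ (Set.Ioi 0) ≠ ⊤ := ENNReal.mul_ne_top (by simp) hfin₀
    have := ENNReal.toReal_mono (ENNReal.add_ne_top.2 ⟨ht1, ht2⟩) h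
    rwa [ENNReal.toReal_add ht1 ht2, ENNReal.toReal_mul, ENNReal.toReal_ofReal hθ.le] at this
  have h2 : m - θ ≤ (μ n).real (Set.Ioi 0) := by
    have := ENNReal.toReal_mono (hfin n) (hn2 0)
    rw [zero_add] at this
    exact hxm.trans this
  have h3 : (k : ℝ) * (m - θ) ≤ k * (μ n).real (Set.Ioi 0) := by gcongr
  linarith

end Comparison

/-! ### Tails of the spectral measure. -/

section SpectralMeasure

variable {G : Type v} [Group G] {U : Type u} [NormedAddCommGroup U] [InnerProductSpace ℂ U]
  [CompleteSpace U] [HilbertModule G U] {V : Type w} [NormedAddCommGroup V]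
  [InnerProductSpace ℂ V] [CompleteSpace V] [HilbertModule G V]

lemma Hom.specDensity_eq_vnDim (f : Hom G U V) {t : ℝ} (ht : ‖f.toCLM‖ ≤ t) :
    f.specDensity t = vnDim G U := by
  refine le_antisymm (iSup₂_le fun L _ => vnDim_sub_le L) ?_
  let L : Sub G U := ⟨⊤, isClosed_univ, fun _ _ _ => trivial⟩
  refine le_iSup₂_of_le L (fun x _ => f.toCLM.le_of_opNorm_le ht x) ?_
  obtain ⟨ι, j₀, hj₀⟩ := exists_embedding (G := G) (V := U)
  let j : Embedding G U ι := ⟨j₀, hj₀⟩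
  rw [← j.hsSq_starProjection L, ← j.hsSq_one]
  exact j.hsSq_mono fun x => by
    rw [Submodule.starProjection_eq_self_iff.2 (show x ∈ L.carrier from trivial)]; rfl

variable [FiniteVNDim G U]

/-- The density is constant, equal to `dim U`, from `‖f‖` on. Keeping the right limit avoids any
need for right-continuity at general `x`. -/
lemma Hom.specMeasure_Ioi (f : Hom G U V) (x : ℝ) :
    f.specMeasure (Set.Ioi x) = ENNReal.ofReal ((vnDim G U).toReal -
      Function.rightLim (fun t : ℝ => (f.specDensity t).toReal) x) := by
  have h : Tendsto f.specDensity_toReal_mono.stieltjesFunction atTop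
      (𝓝 (vnDim G U).toReal) := by
    refine tendsto_const_nhds.congr' ?_
    filter_upwards [eventually_ge_atTop ‖f.toCLM‖] with t ht
    rw [Monotone.stieltjesFunction_eq]
    refine le_antisymm ?_ ?_
    · rw [← f.specDensity_eq_vnDim ht]
      exact f.specDensity_toReal_mono.le_rightLim le_rfl
    · rw [← f.specDensity_eq_vnDim (ht.trans (lt_add_one t).le)]
      exact f.specDensity_toReal_mono.rightLim_le (lt_add_one t)
  rw [Hom.specMeasure, StieltjesFunction.measure_Ioi _ h, Monotone.stieltjesFunction_eq]

lemma Hom.specMeasure_Ioi_norm (f : Hom G U V) : f.specMeasure (Set.Ioi ‖f.toCLM‖) = 0 := by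
  rw [f.specMeasure_Ioi, ENNReal.ofReal_eq_zero, sub_nonpos]
  have := f.specDensity_toReal_mono.le_rightLim (le_refl ‖f.toCLM‖)
  rwa [f.specDensity_eq_vnDim le_rfl] at this

/-- The strict inequality leaves a gap `ε - η`: it is used to step off the right limit at `x`, and
the perturbation then accounts for the remaining `η`. -/
lemma Hom.specMeasure_Ioi_le (f g : Hom G U V) {ε : ℝ} (h : ‖g.toCLM - f.toCLM‖ < ε) (x : ℝ) :
    f.specMeasure (Set.Ioi (x + ε)) ≤ g.specMeasure (Set.Ioi x) := by
  rw [f.specMeasure_Ioi, g.specMeasure_Ioi]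
  refine ENNReal.ofReal_le_ofReal (sub_le_sub_left ?_ _)
  set η := ‖g.toCLM - f.toCLM‖ with hη
  calc Function.rightLim (fun t : ℝ => (g.specDensity t).toReal) x
      ≤ (g.specDensity (x + (ε - η))).toReal :=
        g.specDensity_toReal_mono.rightLim_le (by linarith)
    _ ≤ (f.specDensity (x + (ε - η) + η)).toReal :=
        ENNReal.toReal_mono (f.specDensity_lt_top _).ne
          (g.specDensity_le_add f (by rw [norm_sub_rev]) _)
    _ ≤ _ := f.specDensity_toReal_mono.le_rightLim (by linarith)

theorem limsup_det_le (f : ℕ → Hom G U V) (f₀ : Hom G U V)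
    (hf : Tendsto (fun n => (f n).toCLM) atTop (𝓝 f₀.toCLM)) :
    limsup (fun n => ((f n).det : EReal)) atTop ≤ (f₀.det : EReal) := by
  have hlim := tendsto_iff_norm_sub_tendsto_zero.1 hf
  refine EReal.le_of_forall_lt_iff_le.1 fun c hc => ?_
  refine limsup_le_of_le (by isBoundedDefault) ?_
  have hfin : ∀ g : Hom G U V, g.specMeasure (Set.Ioi 0) ≠ ⊤ := fun g => by
    rw [g.specMeasure_Ioi]; exact ENNReal.ofReal_ne_top
  have := eventually_logDet_le (μ := fun n => (f n).specMeasure) (μ₀ := f₀.specMeasure)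
    (fun n => hfin _) (hfin _) (fun n => ⟨_, (f n).specMeasure_Ioi_norm⟩)
    ⟨_, f₀.specMeasure_Ioi_norm⟩
    (fun ε hε => (hlim.eventually_lt_const hε).mono fun n hn x =>
      (f n).specMeasure_Ioi_le f₀ (by rwa [norm_sub_rev]) x)
    (fun ε hε => (hlim.eventually_lt_const hε).mono fun n hn x =>
      f₀.specMeasure_Ioi_le (f n) hn x)
    (c := c) (EReal.coe_lt_coe_iff.1 hc)
  filter_upwards [this] with n hn
  exact EReal.coe_le_coe_iff.2 hn

end SpectralMeasure

end HilbertModule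

theorem mainTheorem11 {G : Type*} [Group G]
    {U : Type*} [NormedAddCommGroup U] [InnerProductSpace ℂ U] [CompleteSpace U]
    [HilbertModule G U] [HilbertModule.FiniteVNDim G U]
    {V : Type*} [NormedAddCommGroup V] [InnerProductSpace ℂ V] [CompleteSpace V]
    [HilbertModule G V] [HilbertModule.FiniteVNDim G V]
    (f : ℕ → HilbertModule.Hom G U V) (f₀ : HilbertModule.Hom G U V)
    (hf : Tendsto (fun n => (f n).toCLM) atTop (𝓝 f₀.toCLM)) :
    limsup (fun n => HilbertModule.vnDim G (f n).ker.carrier) atTop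
        ≤ HilbertModule.vnDim G f₀.ker.carrier ∧
      limsup (fun n => ((f n).det : EReal)) atTop ≤ (f₀.det : EReal) :=
  ⟨HilbertModule.limsup_vnDim_ker_le f f₀ hf, HilbertModule.limsup_det_le f f₀ hf⟩
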